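/- Let $\mathbb K=\mathbb R$ or $\mathbb C$, and let $c_0=c_0(\mathbb N_0)$ be the Banach space of null sequences $(x_n)_{n\ge 0}$ in $\mathbb K$ with the supremum norm. For a sequence $w=(w_n)_{n\ge1}$ of non-zero scalars, the weighted backward shift is $B_w((x_n)_{n\ge0})=(w_{n+1}x_{n+1})_{n\ge0}$. For $A\subset\mathbb N_0$ let $\underline{\mathrm{dens}}\,A=\liminf_{N\to\infty}\frac{1}{N+1}\operatorname{card}(A\cap[0,N])$ and $A-n=\{k-n: k\in A,\ k\ge n\}$, and let $\mathcal A_{\mathrm{Hin}}$ be Hindman's family of all $A\subset \mathbb N_0$ with $$\lim_{N\to\infty}\underline{\mathrm{dens}}\bigcup_{n=0}^N (A-n)=1 .$$ A continuous map $T:X\to X$ is called very frequently hypercyclic if there is a point $x\in X$ such that $\{n\ge0: T^nx\in U\}\in\mathcal A_{\mathrm{Hin}}$ for every non-empty open set $U\subset X$; it is called chaotic if it has a dense orbit $\{T^nx:n\geq 0\}$ and a dense set of periodic points; and it is called mixing if for all non-empty open sets $U,V\subset X$ there is some $N$ with $T^n(U)\cap V\neq\varnothing$ for all $n\ge N$.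 **Theorem.** There exists a weighted backward shift $B_w$ that is a bounded operator on $c_0$ and is very frequently hypercyclic but not chaotic. In particular, $B_w$ has no eigenvalue $\lambda\in\mathbb K$ with $|\lambda|=1$, it is not mixing, and it admits no non-trivial invariant Gaussian measure: the only Gaussian Borel measure on $c_0$ that is invariant under $B_w$ is the Dirac measure at $0$. (A Borel measure on $c_0$ is Gaussian if every continuous real-linear functional has a, possibly degenerate, real normal distribution under it.) -/

import Mathlib

open Filter Topology MeasureTheory ProbabilityTheory
open scoped ZeroAtInfty

namespace LinearDynamics

/-- The lower density `liminf_{N → ∞} card (A ∩ [0, N]) / (N + 1)` of a set of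
non-negative integers. -/
noncomputable def lowerDensity (A : Set ℕ) : ℝ :=
  liminf (fun N : ℕ => ((A ∩ Set.Icc 0 N).ncard : ℝ) / ((N : ℝ) + 1)) atTop

/-- The translate `A - n = {k - n : k ∈ A, k ≥ n}`. -/
def leftTranslate (A : Set ℕ) (n : ℕ) : Set ℕ := {k | k + n ∈ A}

/-- Hindman's family: the sets `A` such that the lower density of
`(A - 0) ∪ (A - 1) ∪ ... ∪ (A - N)` tends to `1` as `N → ∞`. -/
def hindmanFamily : Set (Set ℕ) :=
  {A | Tendsto (fun N : ℕ => lowerDensity (⋃ n ∈ Set.Icc 0 N, leftTranslate A n)) atTop (𝓝 1)}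

section Dynamics

variable {X : Type*} [TopologicalSpace X]

/-- `T` is `𝒜`-hypercyclic, for a family `𝒜` of sets of non-negative integers. -/
def IsFamilyHypercyclic (𝒜 : Set (Set ℕ)) (T : X → X) : Prop :=
  ∃ x : X, ∀ U : Set X, IsOpen U → U.Nonempty → {n : ℕ | T^[n] x ∈ U} ∈ 𝒜

/-- Very frequent hypercyclicity is hypercyclicity with respect to Hindman's family. -/
def IsVeryFrequentlyHypercyclic (T : X → X) : Prop :=
  IsFamilyHypercyclic hindmanFamily T

/-- `T` is hypercyclic: some point has a dense orbit. -/
def IsHypercyclic (T : X → X) : Prop :=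
  ∃ x : X, Dense (Set.range fun n : ℕ => T^[n] x)

/-- `T` is chaotic: it is hypercyclic and its periodic points are dense. -/
def IsChaotic (T : X → X) : Prop :=
  IsHypercyclic T ∧ Dense (Function.periodicPts T)

/-- `T` is (topologically) mixing. -/
def IsTopologicallyMixing (T : X → X) : Prop :=
  ∀ U V : Set X, IsOpen U → U.Nonempty → IsOpen V → V.Nonempty →
    ∃ N : ℕ, ∀ n ≥ N, (T^[n] '' U ∩ V).Nonempty

end Dynamics

/-- The operator `T` on `c₀` (the continuous functions on the discrete space `ℕ` that vanish at
infinity) is the weighted backward shift `(x_n)_{n ≥ 0} ↦ (w_{n+1} x_{n+1})_{n ≥ 0}` for the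
sequence `(w_n)_{n ≥ 1}` of non-zero scalars; the value `w 0` plays no role. -/
def IsWeightedBackwardShift {𝕜 : Type*} [RCLike 𝕜] (w : ℕ → 𝕜)
    (T : C₀(ℕ, 𝕜) →L[𝕜] C₀(ℕ, 𝕜)) : Prop :=
  (∀ n : ℕ, 1 ≤ n → w n ≠ 0) ∧ ∀ (x : C₀(ℕ, 𝕜)) (n : ℕ), T x n = w (n + 1) * x (n + 1)

end LinearDynamics

/-!
A backward shift with weight products `W n = w 1 * ⋯ * w n` satisfies
`W s * (T^n x)_s = W n * (T^s x)_n`. If `W` is bounded along a sequence `n_k → ∞`, then `T^{n_k} x`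
tends to `0` coordinatewise for every `x`. This rules out mixing, non-zero periodic points,
eigenvalues of modulus at least `1`, and, by dominated convergence, invariant probability measures
other than the Dirac measure at `0`.

Let `W` double at every step except that it is reset to `1` at the times `b_0 = 0` and
`b_{k+1} = b_k + N_k`, where each modulus `N_k` divides the next and the sequence grows fast. A
vector approximating the `p`-th of a sequence of targets at every time of a set `A_p` exists as
soon as `W` is large, compared to `p` and `q`, just after every positive difference of elements of
`A_p` and `A_q`; in other words, as soon as these differences stay away from the intervals
`[b_k, b_k + 2 max(p, q)]`. Since `b_k ≡ b_q` modulo `N_q` for `k ≥ q`, this is a condition on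
finitely many residues modulo `N_q`. One takes for `A_p` the multiples of `N_p` that avoid these
residues modulo `N_q` for all `q > p`. Up to level `Q` the residues are avoided by all numbers
`l * N_Q + 2 * (b_Q - b_p)`, which occur with bounded gaps, and the exceptions caused by the
levels `q > Q` have a density that is small even compared to `1 / N_Q`. Hence `A_p` belongs to
Hindman's family.
-/

namespace LinearDynamics

section Density

lemma ncard_inter_Icc_le (A : Set ℕ) (N : ℕ) : (A ∩ Set.Icc 0 N).ncard ≤ N + 1 := by
  simpa using Set.ncard_le_ncard (Set.inter_subset_right (s := A)) (Set.finite_Icc 0 N)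

lemma ncard_inter_Icc_div_le_one (A : Set ℕ) (N : ℕ) :
    ((A ∩ Set.Icc 0 N).ncard : ℝ) / ((N : ℝ) + 1) ≤ 1 :=
  div_le_one_of_le₀ (mod_cast ncard_inter_Icc_le A N) (by positivity)

lemma isBoundedUnder_ge_ncard_inter_Icc_div (A : Set ℕ) :
    IsBoundedUnder (· ≥ ·) atTop fun N : ℕ => ((A ∩ Set.Icc 0 N).ncard : ℝ) / ((N : ℝ) + 1) :=
  isBoundedUnder_of ⟨0, fun N => by positivity⟩

lemma isCoboundedUnder_ge_ncard_inter_Icc_div (A : Set ℕ) :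
    IsCoboundedUnder (· ≥ ·) atTop fun N : ℕ => ((A ∩ Set.Icc 0 N).ncard : ℝ) / ((N : ℝ) + 1) :=
  (isBoundedUnder_of ⟨1, ncard_inter_Icc_div_le_one A⟩).isCoboundedUnder_ge

lemma lowerDensity_le_one (A : Set ℕ) : lowerDensity A ≤ 1 :=
  liminf_le_of_frequently_le (Frequently.of_forall (ncard_inter_Icc_div_le_one A))
    (isBoundedUnder_ge_ncard_inter_Icc_div A)

lemma lowerDensity_mono {A B : Set ℕ} (h : A ⊆ B) : lowerDensity A ≤ lowerDensity B := by
  refine liminf_le_liminf (Eventually.of_forall fun N => ?_)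
    (isBoundedUnder_ge_ncard_inter_Icc_div A) (isCoboundedUnder_ge_ncard_inter_Icc_div B)
  have : (A ∩ Set.Icc 0 N).ncard ≤ (B ∩ Set.Icc 0 N).ncard :=
    Set.ncard_le_ncard (Set.inter_subset_inter_left _ h)
      ((Set.finite_Icc 0 N).subset Set.inter_subset_right)
  gcongr

lemma one_sub_le_lowerDensity_compl {H : Set ℕ} {δ : ℝ}
    (hH : ∀ᶠ M : ℕ in atTop, ((H ∩ Set.Icc 0 M).ncard : ℝ) ≤ δ * (M + 1)) :
    1 - δ ≤ lowerDensity Hᶜ := by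
  refine le_liminf_of_le (isCoboundedUnder_ge_ncard_inter_Icc_div _) ?_
  filter_upwards [hH] with M hM
  have hsplit : (Set.Icc 0 M ∩ H).ncard + (Set.Icc 0 M \ H).ncard = M + 1 := by simp
  rw [Set.inter_comm, Set.sdiff_eq, Set.inter_comm _ Hᶜ] at hsplit
  have hsplit' : ((H ∩ Set.Icc 0 M).ncard : ℝ) + (Hᶜ ∩ Set.Icc 0 M).ncard = M + 1 :=
    mod_cast hsplit
  rw [le_div_iff₀ (by positivity)]
  linarith

lemma ncard_setOf_exists_add_mem_le (B : Set ℕ) (L M : ℕ) :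
    ({k | ∃ n ≤ L, k + n ∈ B} ∩ Set.Icc 0 M).ncard ≤ (L + 1) * (B ∩ Set.Icc 0 (M + L)).ncard := by
  have hfin : (B ∩ Set.Icc 0 (M + L)).Finite :=
    (Set.finite_Icc 0 (M + L)).subset Set.inter_subset_right
  have hsub : {k | ∃ n ≤ L, k + n ∈ B} ∩ Set.Icc 0 M ⊆
      ⋃ n ∈ Finset.range (L + 1), (fun m => m - n) '' (B ∩ Set.Icc 0 (M + L)) := by
    rintro k ⟨⟨n, hn, hk⟩, -, hkM⟩
    exact Set.mem_biUnion (Finset.mem_coe.2 (Finset.mem_range_succ_iff.2 hn))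
      ⟨k + n, ⟨hk, Nat.zero_le _, by omega⟩, Nat.add_sub_cancel _ _⟩
  calc _ ≤ (⋃ n ∈ Finset.range (L + 1), (fun m => m - n) '' (B ∩ Set.Icc 0 (M + L))).ncard :=
        Set.ncard_le_ncard hsub ((Finset.finite_toSet _).biUnion fun n _ => hfin.image _)
    _ ≤ ∑ n ∈ Finset.range (L + 1), ((fun m => m - n) '' (B ∩ Set.Icc 0 (M + L))).ncard :=
        Finset.set_ncard_biUnion_le _ _
    _ ≤ ∑ _n ∈ Finset.range (L + 1), (B ∩ Set.Icc 0 (M + L)).ncard :=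
        Finset.sum_le_sum fun n _ => Set.ncard_image_le hfin
    _ = _ := by simp

lemma isUpperSet_hindmanFamily : IsUpperSet hindmanFamily := fun _ _ hAB hA =>
  tendsto_of_tendsto_of_tendsto_of_le_of_le hA tendsto_const_nhds
    (fun _ => lowerDensity_mono (Set.iUnion₂_mono fun _ _ _ hk => hAB hk))
    fun _ => lowerDensity_le_one _

lemma mem_hindmanFamily_of_sparse_gaps {A : Set ℕ}
    (h : ∀ δ > (0 : ℝ), ∃ L, ∀ᶠ M : ℕ in atTop,
      (({k | ∀ n ≤ L, k + n ∉ A} ∩ Set.Icc 0 M).ncard : ℝ) ≤ δ * (M + 1)) :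
    A ∈ hindmanFamily := by
  refine tendsto_order.2 ⟨fun c hc => ?_, fun c hc => Eventually.of_forall fun N =>
    (lowerDensity_le_one _).trans_lt hc⟩
  obtain ⟨L, hL⟩ := h ((1 - c) / 2) (by linarith)
  filter_upwards [eventually_ge_atTop L] with N hN
  calc c < 1 - (1 - c) / 2 := by linarith
    _ ≤ lowerDensity {k | ∀ n ≤ L, k + n ∉ A}ᶜ := one_sub_le_lowerDensity_compl hL
    _ ≤ lowerDensity (⋃ n ∈ Set.Icc 0 N, leftTranslate A n) := by
      refine lowerDensity_mono fun k hk => ?_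
      obtain ⟨n, hn, hkn⟩ : ∃ n ≤ L, k + n ∈ A := by simpa using hk
      exact Set.mem_biUnion (show n ∈ Set.Icc 0 N from ⟨n.zero_le, hn.trans hN⟩) hkn

lemma ncard_setOf_natCast_mem_mul_le {N : ℕ} [NeZero N] (R : Finset (ZMod N)) (M : ℕ) :
    ({m : ℕ | N ≤ 2 * m ∧ (m : ZMod N) ∈ R} ∩ Set.Icc 0 M).ncard * N ≤ 3 * R.card * M := by
  rcases lt_or_ge (2 * M) N with hM | hM
  · have : {m : ℕ | N ≤ 2 * m ∧ (m : ZMod N) ∈ R} ∩ Set.Icc 0 M = ∅ :=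
      Set.eq_empty_of_forall_notMem fun m hm => by have := hm.1.1; have := hm.2.2; omega
    simp [this]
  have hsub : {m : ℕ | N ≤ 2 * m ∧ (m : ZMod N) ∈ R} ∩ Set.Icc 0 M ⊆
      (R.biUnion fun r => {m ∈ Finset.range (M + 1) | m ≡ r.val [MOD N]} : Finset ℕ) := by
    rintro m ⟨⟨-, hmR⟩, -, hmM⟩
    rw [Finset.mem_coe, Finset.mem_biUnion]
    refine ⟨m, hmR, Finset.mem_filter.2 ⟨Finset.mem_range_succ_iff.2 hmM, ?_⟩⟩
    rw [ZMod.val_natCast]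
    exact (Nat.mod_modEq m N).symm
  have hclass (r : ZMod N) :
      ({m ∈ Finset.range (M + 1) | m ≡ r.val [MOD N]} : Finset ℕ).card ≤ M / N + 1 := by
    rw [← Nat.count_eq_card_filter_range, Nat.count_modEq_card _ (NeZero.pos N), Nat.succ_div]
    split_ifs with hdvd hlt
    · rw [Nat.mod_eq_zero_of_dvd hdvd] at hlt
      omega
    all_goals omega
  have hcard := (Set.ncard_le_ncard hsub (Finset.finite_toSet _)).trans_eq (Set.ncard_coe_finset _)
  calc _ ≤ R.card * (M / N + 1) * N :=
        Nat.mul_le_mul_right _ (hcard.trans (Finset.card_biUnion_le_card_mul _ _ _ fun r _ =>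
          hclass r))
    _ = R.card * (M / N * N + N) := by ring
    _ ≤ R.card * (3 * M) := Nat.mul_le_mul_left _ (by have := Nat.div_mul_le_self M N; omega)
    _ = 3 * R.card * M := by ring

end Density

section NullSequences

/-- The element of `C₀(ℕ, E)` given by a null sequence. -/
def nullSequence {E : Type*} [TopologicalSpace E] [Zero E] (f : ℕ → E)
    (hf : Tendsto f atTop (𝓝 0)) : C₀(ℕ, E) where
  toFun := f
  continuous_toFun := continuous_of_discreteTopology
  zero_at_infty' := by rwa [cocompact_eq_atTop]

@[simp]
lemma nullSequence_apply {E : Type*} [TopologicalSpace E] [Zero E] (f : ℕ → E)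
    (hf : Tendsto f atTop (𝓝 0)) (n : ℕ) : nullSequence f hf n = f n := rfl

lemma tendsto_apply_atTop {E : Type*} [TopologicalSpace E] [Zero E] (x : C₀(ℕ, E)) :
    Tendsto x atTop (𝓝 0) := by
  simpa only [cocompact_eq_atTop] using zero_at_infty x

section Norm

variable {α E : Type*} [TopologicalSpace α] [SeminormedAddCommGroup E]

lemma norm_apply_le (x : C₀(α, E)) (a : α) : ‖x a‖ ≤ ‖x‖ := x.toBCF.norm_coe_le_norm a

lemma norm_le_of_forall_apply {x : C₀(α, E)} {C : ℝ} (hC : 0 ≤ C) (h : ∀ a, ‖x a‖ ≤ C) :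
    ‖x‖ ≤ C :=
  (BoundedContinuousFunction.norm_le hC).2 h

lemma continuous_evalConst (a : α) : Continuous fun x : C₀(α, E) => x a :=
  LipschitzWith.continuous (K := 1) <| LipschitzWith.of_dist_le_mul fun x y => by
    rw [NNReal.coe_one, one_mul, dist_eq_norm, dist_eq_norm]
    exact norm_apply_le (x - y) a

end Norm

variable (𝕜 : Type*) [RCLike 𝕜]

lemma exists_one_lt_norm_apply_zero : ∃ x : C₀(ℕ, 𝕜), 1 < ‖x 0‖ := by
  refine ⟨nullSequence (Pi.single 0 2) (tendsto_const_nhds.congr' ?_), by simp⟩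
  filter_upwards [eventually_ne_atTop 0] with n hn
  rw [Pi.single_eq_of_ne hn]

lemma exists_denseRange_eventually_eq_zero :
    ∃ u : ℕ → C₀(ℕ, 𝕜), DenseRange u ∧ ∀ a, ∀ᶠ j in atTop, u a j = 0 := by
  set D := TopologicalSpace.denseSeq (ℕ → 𝕜)
  let f (a K j : ℕ) : 𝕜 := if j < K then D a j else 0
  have hf (a K) : ∀ᶠ j in atTop, f a K j = 0 := by
    filter_upwards [eventually_ge_atTop K] with j hj using if_neg hj.not_gt
  let u (q : ℕ) := nullSequence (f q.unpair.1 q.unpair.2)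
    (tendsto_const_nhds.congr' ((hf _ _).mono fun _ => Eq.symm))
  refine ⟨u, Metric.denseRange_iff.2 fun x r hr => ?_, fun q => hf _ _⟩
  obtain ⟨K, hK⟩ := Metric.tendsto_atTop.1 (tendsto_apply_atTop x) (r / 2) (half_pos hr)
  have hopen : IsOpen {g : ℕ → 𝕜 | ∀ j ∈ Set.Iio K, dist (g j) (x j) < r / 2} := by
    simp only [Set.ofPred_forall]
    exact (Set.finite_Iio K).isOpen_biInter fun j _ =>
      isOpen_lt ((continuous_apply j).dist continuous_const) continuous_const
  obtain ⟨a, ha⟩ := (TopologicalSpace.denseRange_denseSeq (ℕ → 𝕜)).exists_mem_open hopen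
    ⟨x, fun j _ => by simpa using half_pos hr⟩
  refine ⟨Nat.pair a K, ?_⟩
  rw [dist_comm, dist_eq_norm]
  refine (norm_le_of_forall_apply (half_pos hr).le fun j => ?_).trans_lt (half_lt_self hr)
  simp only [u, f, Nat.unpair_pair, ZeroAtInftyContinuousMap.sub_apply, nullSequence_apply]
  split_ifs with hj
  · simpa only [dist_eq_norm] using (ha j hj).le
  · simpa using (hK j (not_lt.1 hj)).le

end NullSequences

section Invariance

lemma eq_dirac_of_ae_eq {α : Type*} [MeasurableSpace α] {μ : Measure α} [IsProbabilityMeasure μ]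
    {a : α} (h : ∀ᵐ x ∂μ, x = a) : μ = Measure.dirac a := by
  calc μ = μ.map id := Measure.map_id.symm
    _ = μ.map (fun _ => a) := Measure.map_congr h
    _ = Measure.dirac a := by rw [Measure.map_const, measure_univ, one_smul]

lemma ae_eq_zero_of_tendsto_comp_iterate {α E : Type*} [MeasurableSpace α] [NormedAddCommGroup E]
    {μ : Measure α} [IsFiniteMeasure μ] {T : α → α} (hT : MeasurePreserving T μ μ) {f : α → E}
    (hf : StronglyMeasurable f) {φ : ℕ → ℕ}
    (h : ∀ x, Tendsto (fun k => f (T^[φ k] x)) atTop (𝓝 0)) : f =ᵐ[μ] 0 := by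
  let g (x : α) : ENNReal := min ‖f x‖ₑ 1
  have hg : Measurable g := hf.enorm.min measurable_const
  have hlim : Tendsto (fun k => ∫⁻ x, g (T^[φ k] x) ∂μ) atTop (𝓝 0) := by
    have := tendsto_lintegral_of_dominated_convergence (μ := μ) (f := fun _ => 0)
      (F := fun k x => g (T^[φ k] x)) 1
      (fun k => hg.comp (hT.iterate _).measurable) (fun k => ae_of_all _ fun x => min_le_right _ _)
      (by simp) (ae_of_all _ fun x => by simpa using (h x).enorm.min tendsto_const_nhds)
    simpa using this
  have hinv (k : ℕ) : ∫⁻ x, g (T^[φ k] x) ∂μ = ∫⁻ x, g x ∂μ :=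
    (hT.iterate (φ k)).lintegral_comp hg
  simp only [hinv] at hlim
  have hzero : g =ᵐ[μ] 0 :=
    (lintegral_eq_zero_iff hg).1 (tendsto_nhds_unique tendsto_const_nhds hlim)
  filter_upwards [hzero] with x hx
  simpa [g] using hx

end Invariance

section WeightProduct

/-- The product `w 1 * ⋯ * w n` of the first `n` weights. The weight `w 0` does not occur, in
accordance with `IsWeightedBackwardShift`. -/
def weightProduct {M : Type*} [CommMonoid M] (w : ℕ → M) (n : ℕ) : M :=
  ∏ i ∈ Finset.range n, w (i + 1)

lemma weightProduct_succ {M : Type*} [CommMonoid M] (w : ℕ → M) (n : ℕ) :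
    weightProduct w (n + 1) = weightProduct w n * w (n + 1) :=
  Finset.prod_range_succ _ _

lemma weightProduct_div_pred {G : Type*} [CommGroupWithZero G] {W : ℕ → G} (hW : ∀ n, W n ≠ 0)
    (h0 : W 0 = 1) (n : ℕ) : weightProduct (fun n => W n / W (n - 1)) n = W n := by
  induction n with
  | zero => simp [weightProduct, h0]
  | succ n ih =>
    rw [weightProduct_succ, ih, Nat.add_sub_cancel, mul_div_cancel₀ _ (hW n)]

end WeightProduct

lemma exists_isWeightedBackwardShift {𝕜 : Type*} [RCLike 𝕜] {w : ℕ → 𝕜} {C : ℝ}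
    (hw : ∀ n, w n ≠ 0) (hC : ∀ n, ‖w n‖ ≤ C) :
    ∃ T : C₀(ℕ, 𝕜) →L[𝕜] C₀(ℕ, 𝕜), IsWeightedBackwardShift w T := by
  have hC0 : 0 ≤ C := (norm_nonneg _).trans (hC 0)
  have hlim (x : C₀(ℕ, 𝕜)) : Tendsto (fun n => w (n + 1) * x (n + 1)) atTop (𝓝 0) := by
    have hx : Tendsto (fun n => C * ‖x (n + 1)‖) atTop (𝓝 0) := by
      simpa using ((tendsto_add_atTop_iff_nat 1).2 (tendsto_apply_atTop x)).norm.const_mul C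
    refine squeeze_zero_norm (fun n => ?_) hx
    rw [norm_mul]
    exact mul_le_mul_of_nonneg_right (hC _) (norm_nonneg _)
  let B : C₀(ℕ, 𝕜) →ₗ[𝕜] C₀(ℕ, 𝕜) :=
    { toFun := fun x => nullSequence _ (hlim x)
      map_add' := fun x y => by ext n; simp [mul_add]
      map_smul' := fun c x => by ext n; simp [mul_left_comm] }
  refine ⟨B.mkContinuous C fun x => ?_, fun n _ => hw n, fun x n => rfl⟩
  refine norm_le_of_forall_apply (by positivity) fun n => ?_
  calc ‖w (n + 1) * x (n + 1)‖ = ‖w (n + 1)‖ * ‖x (n + 1)‖ := norm_mul _ _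
    _ ≤ C * ‖x‖ := by gcongr; exacts [hC _, norm_apply_le x _]

namespace IsWeightedBackwardShift

variable {𝕜 : Type*} [RCLike 𝕜] {w : ℕ → 𝕜} {T : C₀(ℕ, 𝕜) →L[𝕜] C₀(ℕ, 𝕜)}

lemma weightProduct_ne_zero (hT : IsWeightedBackwardShift w T) (n : ℕ) : weightProduct w n ≠ 0 :=
  Finset.prod_ne_zero_iff.2 fun _ _ => hT.1 _ (Nat.succ_pos _)

lemma weightProduct_mul_iterate_apply (hT : IsWeightedBackwardShift w T) (x : C₀(ℕ, 𝕜))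
    (m n : ℕ) :
    weightProduct w n * (T^[m] x) n = weightProduct w (n + m) * x (n + m) := by
  induction m generalizing x with
  | zero => rfl
  | succ m ih =>
    rw [Function.iterate_succ_apply, ih, hT.2, ← mul_assoc, ← add_assoc,
      weightProduct_succ]

lemma iterate_apply_zero (hT : IsWeightedBackwardShift w T) (x : C₀(ℕ, 𝕜)) (n : ℕ) :
    (T^[n] x) 0 = weightProduct w n * x n := by
  simpa [weightProduct] using hT.weightProduct_mul_iterate_apply x n 0

lemma tendsto_iterate_apply_of_bounded (hT : IsWeightedBackwardShift w T) {C : ℝ} {φ : ℕ → ℕ}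
    (hφ : StrictMono φ) (hC : ∀ k, ‖weightProduct w (φ k)‖ ≤ C) (x : C₀(ℕ, 𝕜)) (s : ℕ) :
    Tendsto (fun k => (T^[φ k] x) s) atTop (𝓝 0) := by
  have hswap (k : ℕ) : weightProduct w s * (T^[φ k] x) s =
      weightProduct w (φ k) * (T^[s] x) (φ k) := by
    rw [hT.weightProduct_mul_iterate_apply, hT.weightProduct_mul_iterate_apply, add_comm]
  have hnull : Tendsto (fun k => C * ‖(T^[s] x) (φ k)‖) atTop (𝓝 0) := by
    simpa using ((tendsto_apply_atTop (T^[s] x)).comp hφ.tendsto_atTop).norm.const_mul C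
  have hlim : Tendsto (fun k => weightProduct w s * (T^[φ k] x) s) atTop (𝓝 0) := by
    refine squeeze_zero_norm (fun k => ?_) hnull
    rw [hswap, norm_mul]
    exact mul_le_mul_of_nonneg_right (hC k) (norm_nonneg _)
  simpa [hT.weightProduct_ne_zero s] using hlim.const_mul (weightProduct w s)⁻¹

lemma exists_seq_tendsto_iterate_apply (hT : IsWeightedBackwardShift w T)
    (hw : ¬ Tendsto (fun n => ‖weightProduct w n‖) atTop atTop) :
    ∃ φ : ℕ → ℕ, ∀ x s, Tendsto (fun k => (T^[φ k] x) s) atTop (𝓝 0) := by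
  simp only [tendsto_atTop, not_forall, not_eventually, not_le] at hw
  obtain ⟨C, hC⟩ := hw
  obtain ⟨φ, hφ, hφC⟩ := extraction_of_frequently_atTop hC
  exact ⟨φ, hT.tendsto_iterate_apply_of_bounded hφ fun k => (hφC k).le⟩

lemma not_hasEigenvalue (hT : IsWeightedBackwardShift w T)
    (hw : ¬ Tendsto (fun n => ‖weightProduct w n‖) atTop atTop) {c : 𝕜} (hc : 1 ≤ ‖c‖) :
    ¬ Module.End.HasEigenvalue (T : C₀(ℕ, 𝕜) →ₗ[𝕜] C₀(ℕ, 𝕜)) c := by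
  intro hev
  obtain ⟨x, hx⟩ := hev.exists_hasEigenvector
  obtain ⟨φ, hφ⟩ := hT.exists_seq_tendsto_iterate_apply hw
  have hiter (n : ℕ) : T^[n] x = c ^ n • x := by
    simpa only [Module.End.pow_apply, ContinuousLinearMap.coe_coe] using hx.pow_apply n
  refine hx.2 (ZeroAtInftyContinuousMap.ext fun s => norm_le_zero_iff.1 ?_)
  have hlim : Tendsto (fun k => ‖(T^[φ k] x) s‖) atTop (𝓝 0) := by simpa using (hφ x s).norm
  refine ge_of_tendsto' hlim fun k => ?_
  rw [hiter, ZeroAtInftyContinuousMap.smul_apply, norm_smul, norm_pow]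
  exact le_mul_of_one_le_left (norm_nonneg _) (one_le_pow₀ hc)

lemma periodicPts_subset (hT : IsWeightedBackwardShift w T)
    (hw : ¬ Tendsto (fun n => ‖weightProduct w n‖) atTop atTop) :
    Function.periodicPts T ⊆ {0} := by
  rintro x ⟨p, hp, hper⟩
  obtain ⟨φ, hφ⟩ := hT.exists_seq_tendsto_iterate_apply hw
  have hlim : Tendsto (fun k => ⇑(T^[φ k] x)) atTop (𝓝 (0 : ℕ → 𝕜)) := tendsto_pi_nhds.2 (hφ x)
  have hclosed : IsClosed ((fun j => ⇑(T^[j] x)) '' Set.Iio p : Set (ℕ → 𝕜)) :=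
    ((Set.finite_Iio p).image _).isClosed
  obtain ⟨j, -, hj⟩ := hclosed.mem_of_tendsto hlim <| Eventually.of_forall fun k =>
    ⟨φ k % p, Nat.mod_lt _ hp, congrArg _ (hper.iterate_mod_apply _)⟩
  have hj0 : T^[j] x = 0 := DFunLike.coe_injective hj
  calc x = T^[p * j] x := ((hper.mul_const j).eq).symm
    _ = T^[p * j - j] (T^[j] x) := by
      rw [← Function.iterate_add_apply, Nat.sub_add_cancel (Nat.le_mul_of_pos_left j hp)]
    _ = 0 := by rw [hj0, iterate_map_zero]

lemma not_dense_periodicPts (hT : IsWeightedBackwardShift w T)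
    (hw : ¬ Tendsto (fun n => ‖weightProduct w n‖) atTop atTop) :
    ¬ Dense (Function.periodicPts T) := by
  intro hdense
  obtain ⟨x, hx, hper⟩ := hdense.exists_mem_open
    (isOpen_lt continuous_const (continuous_evalConst 0).norm) (exists_one_lt_norm_apply_zero 𝕜)
  rw [hT.periodicPts_subset hw hx] at hper
  norm_num at hper

lemma not_isTopologicallyMixing (hT : IsWeightedBackwardShift w T)
    (hw : ¬ Tendsto (fun n => ‖weightProduct w n‖) atTop atTop) : ¬ IsTopologicallyMixing T := by
  intro hmix
  refine hw (tendsto_atTop.2 fun C => ?_)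
  wlog hC : 0 < C generalizing C
  · exact (this 1 one_pos).mono fun n hn => (not_lt.1 hC).trans (zero_le_one.trans hn)
  obtain ⟨N, hN⟩ := hmix (Metric.ball 0 C⁻¹) {x | 1 < ‖x 0‖} Metric.isOpen_ball
    (Metric.nonempty_ball.2 (inv_pos.2 hC))
    (isOpen_lt continuous_const (continuous_evalConst 0).norm) (exists_one_lt_norm_apply_zero 𝕜)
  filter_upwards [eventually_ge_atTop N] with n hn
  obtain ⟨-, ⟨x, hx, rfl⟩, hgt⟩ := hN n hn
  rw [mem_ball_zero_iff] at hx
  rw [Set.mem_ofPred_eq, hT.iterate_apply_zero, norm_mul] at hgt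
  by_contra! hlt
  refine hgt.not_ge ?_
  calc ‖weightProduct w n‖ * ‖x n‖ ≤ C * C⁻¹ := by
        gcongr
        exact (norm_apply_le x n).trans hx.le
    _ = 1 := mul_inv_cancel₀ hC.ne'

lemma eq_dirac_zero_of_measurePreserving [MeasurableSpace C₀(ℕ, 𝕜)] [BorelSpace C₀(ℕ, 𝕜)]
    (hT : IsWeightedBackwardShift w T)
    (hw : ¬ Tendsto (fun n => ‖weightProduct w n‖) atTop atTop) {μ : Measure C₀(ℕ, 𝕜)}
    [IsProbabilityMeasure μ] (hμ : MeasurePreserving T μ μ) : μ = Measure.dirac 0 := by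
  obtain ⟨φ, hφ⟩ := hT.exists_seq_tendsto_iterate_apply hw
  have hcoord (s : ℕ) : ∀ᵐ x ∂μ, x s = 0 :=
    ae_eq_zero_of_tendsto_comp_iterate hμ (continuous_evalConst s).stronglyMeasurable
      fun x => hφ x s
  refine eq_dirac_of_ae_eq ?_
  filter_upwards [ae_all_iff.2 hcoord] with x hx using ZeroAtInftyContinuousMap.ext hx

end IsWeightedBackwardShift

section Criterion

lemma exists_seq_forall_frequently_eq {α : Type*} {P : ℕ → α → Prop} (u : ℕ → α) {z : α}
    (hz : ∀ q, P q z) (hu : ∀ a, ∀ᶠ q in atTop, P q (u a)) :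
    ∃ v : ℕ → α, (∀ q, P q (v q)) ∧ ∀ a, ∃ᶠ q in atTop, v q = u a := by
  classical
  refine ⟨fun q => if P q (u q.unpair.1) then u q.unpair.1 else z, fun q => ?_, fun a => ?_⟩
  · dsimp only
    split_ifs with h
    exacts [h, hz q]
  · obtain ⟨Q₀, hQ₀⟩ := eventually_atTop.1 (hu a)
    refine frequently_atTop.2 fun Q => ⟨Nat.pair a (max Q Q₀), ?_, ?_⟩
    · exact (le_max_left _ _).trans (Nat.right_le_pair _ _)
    · simp [hQ₀ _ ((le_max_right Q Q₀).trans (Nat.right_le_pair a _))]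

variable {𝕜 : Type*} [RCLike 𝕜]

lemma exists_slow_dense_seq (W : ℕ → 𝕜) :
    ∃ v : ℕ → C₀(ℕ, 𝕜), (∀ q j, q < j → v q j = 0) ∧ (∀ q j, ‖W j * v q j‖ ≤ 2 ^ q) ∧
      ∀ x, ∀ ε > 0, ∃ᶠ q in atTop, ‖v q - x‖ < ε := by
  obtain ⟨u, hdense, hu⟩ := exists_denseRange_eventually_eq_zero 𝕜
  have hslow (a : ℕ) :
      ∀ᶠ q in atTop, (∀ j, q < j → u a j = 0) ∧ ∀ j, ‖W j * u a j‖ ≤ 2 ^ q := by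
    obtain ⟨K, hK⟩ := eventually_atTop.1 (hu a)
    have hpow (j : ℕ) : ∀ᶠ q : ℕ in atTop, ‖W j * u a j‖ ≤ 2 ^ q :=
      (tendsto_pow_atTop_atTop_of_one_lt one_lt_two).eventually_ge_atTop _
    filter_upwards [eventually_ge_atTop K, (Set.finite_Iio K).eventually_all.2 fun j _ => hpow j]
      with q hq hqpow
    refine ⟨fun j hj => hK j (hq.trans hj.le), fun j => ?_⟩
    rcases lt_or_ge j K with hj | hj
    · exact hqpow j hj
    · rw [hK j hj, mul_zero, norm_zero]
      positivity
  obtain ⟨v, hv, hfreq⟩ := exists_seq_forall_frequently_eq u (z := 0)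
    (P := fun q x => (∀ j, q < j → x j = 0) ∧ ∀ j, ‖W j * x j‖ ≤ 2 ^ q)
    (fun q => ⟨fun _ _ => rfl, fun j => by simp⟩) hslow
  refine ⟨v, fun q => (hv q).1, fun q => (hv q).2, fun x ε hε => ?_⟩
  obtain ⟨a, ha⟩ := Metric.denseRange_iff.1 hdense x ε hε
  refine (hfreq a).mono fun q hq => ?_
  rwa [hq, ← dist_eq_norm, dist_comm]

lemma div_le_half_pow {a b : ℝ} {p K : ℕ} (ha : a ≤ 2 ^ p) (hb : 4 ^ max p K ≤ b) :
    a / b ≤ (1 / 2) ^ K := by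
  have hb0 : 0 < b := lt_of_lt_of_le (by positivity) hb
  rw [div_le_iff₀ hb0]
  calc a ≤ 2 ^ max p K := ha.trans (pow_le_pow_right₀ one_le_two (le_max_left _ _))
    _ = (1 / 2) ^ max p K * 4 ^ max p K := by rw [← mul_pow]; norm_num
    _ ≤ (1 / 2) ^ K * b := by
      gcongr ?_ * ?_
      exact pow_le_pow_of_le_one (by norm_num) (by norm_num) (le_max_right _ _)

/-- A separation condition on a sequence of sets `A p` of return times, relative to `W : ℕ → ℝ`.
A vector approximating a given target at all times in `A p` is assembled from the blocks
`[m, m + p]` with `m ∈ A p`: by `gap` the blocks do not overlap, `weight_sub` makes the other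
blocks contribute little at a given return time, and `weight_add` makes the vector null at
infinity. -/
structure IsSeparatedFamily (W : ℕ → ℝ) (A : ℕ → Set ℕ) : Prop where
  index_eq : ∀ {p q m}, m ∈ A p → m ∈ A q → p = q
  gap : ∀ {p q m n}, m ∈ A p → n ∈ A q → n < m → n + q < m
  weight_sub : ∀ {p q m n t}, m ∈ A p → n ∈ A q → n < m → t ≤ p → 4 ^ max p q ≤ W (m - n + t)
  weight_add : ∀ K, ∀ᶠ i in atTop, ∀ {p m t}, m ∈ A p → t ≤ p → m + t = i → 4 ^ max p K ≤ W i

namespace IsSeparatedFamily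

variable {W : ℕ → ℝ} {A : ℕ → Set ℕ}

lemma block_injective (hA : IsSeparatedFamily W A) {p q m n s t : ℕ} (hm : m ∈ A p) (hn : n ∈ A q)
    (hs : s ≤ p) (ht : t ≤ q) (h : m + s = n + t) : p = q ∧ s = t := by
  rcases lt_trichotomy m n with hmn | rfl | hmn
  · have := hA.gap hn hm hmn
    omega
  · exact ⟨hA.index_eq hm hn, by omega⟩
  · have := hA.gap hm hn hmn
    omega

lemma exists_blockwise (hA : IsSeparatedFamily W A) {E : Type*} [Zero E] (f : ℕ → ℕ → E) :
    ∃ y : ℕ → E, (∀ {p m t}, m ∈ A p → t ≤ p → y (m + t) = f p t) ∧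
      ∀ {i}, y i ≠ 0 → ∃ p, ∃ m ∈ A p, ∃ t ≤ p, m + t = i := by
  classical
  let IsIn (i : ℕ) (b : ℕ × ℕ) : Prop := b.2 ≤ b.1 ∧ ∃ m ∈ A b.1, m + b.2 = i
  refine ⟨fun i => if h : ∃ b, IsIn i b then f h.choose.1 h.choose.2 else 0, ?_, ?_⟩
  · intro p m t hm ht
    have h : ∃ b, IsIn (m + t) b := ⟨(p, t), ht, m, hm, rfl⟩
    obtain ⟨hle, n, hn, hnm⟩ := h.choose_spec
    obtain ⟨hp, ht⟩ := hA.block_injective hn hm hle ht hnm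
    simp only [dif_pos h, hp, ht]
  · intro i hi
    obtain ⟨⟨p, t⟩, ht, m, hm, hmt⟩ : ∃ b, IsIn i b := by
      by_contra h
      exact hi (dif_neg h)
    exact ⟨p, m, hm, t, ht, hmt⟩

lemma tendsto_div {y u : ℕ → 𝕜} (hA : IsSeparatedFamily (fun i => ‖u i‖) A)
    (hy : ∀ {i}, y i ≠ 0 → ∃ p, ∃ m ∈ A p, ∃ t ≤ p, m + t = i ∧ ‖y i‖ ≤ 2 ^ p) :
    Tendsto (fun i => y i / u i) atTop (𝓝 0) := by
  refine NormedAddGroup.tendsto_nhds_zero.2 fun ε hε => ?_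
  obtain ⟨K, hK⟩ := exists_pow_lt_of_lt_one hε one_half_lt_one
  filter_upwards [hA.weight_add K] with i hi
  by_cases hyi : y i = 0
  · simpa [hyi]
  obtain ⟨p, m, hm, t, ht, hmt, hle⟩ := hy hyi
  rw [norm_div]
  exact (div_le_half_pow hle (hi hm ht hmt)).trans_lt hK

end IsSeparatedFamily

namespace IsWeightedBackwardShift

variable {w : ℕ → 𝕜} {T : C₀(ℕ, 𝕜) →L[𝕜] C₀(ℕ, 𝕜)} {A : ℕ → Set ℕ}

lemma exists_forall_norm_iterate_sub_le (hT : IsWeightedBackwardShift w T)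
    (hA : IsSeparatedFamily (fun n => ‖weightProduct w n‖) A) {v : ℕ → C₀(ℕ, 𝕜)}
    (hsupp : ∀ q j, q < j → v q j = 0) (hv : ∀ q j, ‖weightProduct w j * v q j‖ ≤ 2 ^ q) :
    ∃ x, ∀ q, ∀ n ∈ A q, ‖T^[n] x - v q‖ ≤ (1 / 2) ^ q := by
  obtain ⟨y, hy, hy0⟩ := hA.exists_blockwise fun p t => weightProduct w t * v p t
  have hblock {i : ℕ} (hi : y i ≠ 0) :
      ∃ p, ∃ m ∈ A p, ∃ t ≤ p, m + t = i ∧ ‖y i‖ ≤ 2 ^ p := by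
    obtain ⟨p, m, hm, t, ht, rfl⟩ := hy0 hi
    exact ⟨p, m, hm, t, ht, rfl, hy hm ht ▸ hv p t⟩
  have hlim : Tendsto (fun i => y i / weightProduct w i) atTop (𝓝 0) := hA.tendsto_div hblock
  refine ⟨nullSequence _ hlim, fun q n hn => norm_le_of_forall_apply (by positivity) fun j => ?_⟩
  have hiter : (T^[n] (nullSequence _ hlim)) j = y (n + j) / weightProduct w j := by
    rw [eq_div_iff (hT.weightProduct_ne_zero j), mul_comm, hT.weightProduct_mul_iterate_apply,
      nullSequence_apply, mul_div_cancel₀ _ (hT.weightProduct_ne_zero _), add_comm]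
  rw [ZeroAtInftyContinuousMap.sub_apply, hiter]
  rcases le_or_gt j q with hj | hj
  · rw [hy hn hj, mul_div_cancel_left₀ _ (hT.weightProduct_ne_zero j), sub_self, norm_zero]
    positivity
  rw [hsupp q j hj, sub_zero, norm_div]
  by_cases hyj : y (n + j) = 0
  · simp [hyj]
  obtain ⟨p, m, hm, t, ht, hmt, hle⟩ := hblock hyj
  have hnm : n < m := by
    by_contra! hmn
    rcases hmn.eq_or_lt with rfl | hmn
    · have := hA.index_eq hm hn
      omega
    · have := hA.gap hn hm hmn
      omega
  rw [show j = m - n + t by omega] at hle ⊢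
  exact div_le_half_pow hle (hA.weight_sub hm hn hnm ht)

lemma isFamilyHypercyclic (hT : IsWeightedBackwardShift w T)
    (hA : IsSeparatedFamily (fun n => ‖weightProduct w n‖) A) {𝒜 : Set (Set ℕ)}
    (h𝒜 : IsUpperSet 𝒜) (hA𝒜 : ∀ p, A p ∈ 𝒜) : IsFamilyHypercyclic 𝒜 T := by
  obtain ⟨v, hsupp, hv, hdense⟩ := exists_slow_dense_seq (weightProduct w)
  obtain ⟨x, hx⟩ := hT.exists_forall_norm_iterate_sub_le hA hsupp hv
  refine ⟨x, fun U hU ⟨a, ha⟩ => ?_⟩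
  obtain ⟨ε, hε, hball⟩ := Metric.isOpen_iff.1 hU a ha
  have hsmall : ∀ᶠ q : ℕ in atTop, (1 / 2 : ℝ) ^ q < ε / 2 :=
    (tendsto_pow_atTop_nhds_zero_of_lt_one (by norm_num) one_half_lt_one).eventually_lt_const
      (half_pos hε)
  obtain ⟨q, hqa, hq⟩ := ((hdense a (ε / 2) (half_pos hε)).and_eventually hsmall).exists
  refine h𝒜 (fun n hn => hball ?_) (hA𝒜 q)
  rw [Metric.mem_ball, dist_eq_norm]
  calc ‖T^[n] x - a‖ ≤ ‖T^[n] x - v q‖ + ‖v q - a‖ := norm_sub_le_norm_sub_add_norm_sub _ _ _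
    _ < ε / 2 + ε / 2 := add_lt_add ((hx q n hn).trans_lt hq) hqa
    _ = ε := add_halves ε

end IsWeightedBackwardShift

end Criterion

section Elapsed

open Classical in
/-- The time elapsed at `n` since the last element of the set `S` of reset times; the clock also
starts at time `0`. -/
noncomputable def elapsed (S : Set ℕ) : ℕ → ℕ
  | 0 => 0
  | n + 1 => if n + 1 ∈ S then 0 else elapsed S n + 1

variable {S : Set ℕ}

lemma elapsed_of_mem {n : ℕ} (h : n ∈ S) : elapsed S n = 0 := by
  cases n with
  | zero => rfl
  | succ n => rw [elapsed, if_pos h]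

lemma elapsed_succ_le (S : Set ℕ) (n : ℕ) : elapsed S (n + 1) ≤ elapsed S n + 1 := by
  rw [elapsed]
  split_ifs <;> omega

lemma elapsed_add_le (S : Set ℕ) (m n : ℕ) : elapsed S (m + n) ≤ elapsed S m + n := by
  induction n with
  | zero => rfl
  | succ n ih => exact (elapsed_succ_le S (m + n)).trans (by omega)

lemma elapsed_le (S : Set ℕ) (n : ℕ) : elapsed S n ≤ n := by
  simpa [elapsed] using elapsed_add_le S 0 n

lemma add_elapsed_le_of_mem {s n : ℕ} (hs : s ∈ S) (hsn : s ≤ n) : s + elapsed S n ≤ n := by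
  have := elapsed_add_le S s (n - s)
  rw [Nat.add_sub_cancel' hsn, elapsed_of_mem hs] at this
  omega

lemma exists_mem_add_elapsed_eq (h0 : 0 ∈ S) (n : ℕ) : ∃ s ∈ S, s + elapsed S n = n := by
  induction n with
  | zero => exact ⟨0, h0, rfl⟩
  | succ n ih =>
    rw [elapsed]
    split_ifs with h
    · exact ⟨n + 1, h, rfl⟩
    · obtain ⟨s, hs, hsn⟩ := ih
      exact ⟨s, hs, by omega⟩

lemma not_tendsto_two_pow_elapsed {S : Set ℕ} (hS : S.Infinite) :
    ¬ Tendsto (fun n => (2 : ℝ) ^ elapsed S n) atTop atTop := by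
  intro h
  obtain ⟨N, hN⟩ := eventually_atTop.1 (h.eventually_gt_atTop 1)
  obtain ⟨n, hn, hNn⟩ := hS.exists_gt N
  simpa [elapsed_of_mem hn] using hN n hNn.le

end Elapsed

section ResetTimes

lemma intCast_ne_zero_of_pos_of_lt {N : ℕ} {z : ℤ} (hz : 0 < z) (hzN : z < N) :
    (z : ZMod N) ≠ 0 := fun h =>
  hz.ne' <| Int.eq_zero_of_dvd_of_nonneg_of_lt hz.le hzN <|
    (ZMod.intCast_zmod_eq_zero_iff_dvd z N).1 h

/-- The moduli of the construction. The factor `modulus q ^ 2 * 2 ^ (q + 1)` makes the sets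
`forbidden (q + 1)` sparse even after thickening them by windows of length comparable to
`modulus q`, and `24 * (q + 2) ^ 2` absorbs the number of forbidden residues. -/
def modulus : ℕ → ℕ
  | 0 => 16
  | q + 1 => modulus q ^ 2 * (24 * (q + 2) ^ 2 * 2 ^ (q + 1))

/-- The times at which the product of the weights is reset to `1`. -/
def resetTime (k : ℕ) : ℕ := ∑ j ∈ Finset.range k, modulus j

lemma resetTime_succ (k : ℕ) : resetTime (k + 1) = resetTime k + modulus k :=
  Finset.sum_range_succ _ _

lemma modulus_dvd_modulus {q r : ℕ} (h : q ≤ r) : modulus q ∣ modulus r :=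
  Nat.le_induction dvd_rfl
    (fun _ _ ih => ih.trans (dvd_mul_of_dvd_left (dvd_pow_self _ two_ne_zero) _)) r h

lemma resetTime_le_modulus (q : ℕ) : 8 * resetTime q + 16 * (q + 1) ≤ modulus q := by
  induction q with
  | zero => rfl
  | succ q ih =>
    have hpos : 1 ≤ 24 * (q + 2) ^ 2 * 2 ^ (q + 1) := Nat.one_le_iff_ne_zero.2 (by positivity)
    have hsq : modulus q * 16 * 1 ≤ modulus q * modulus q * (24 * (q + 2) ^ 2 * 2 ^ (q + 1)) := by
      gcongr
      omega
    rw [resetTime_succ, modulus, sq]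
    omega

lemma modulus_pos (q : ℕ) : 0 < modulus q := by
  have := resetTime_le_modulus q
  omega

lemma modulus_mono : Monotone modulus := fun _ r h =>
  Nat.le_of_dvd (modulus_pos r) (modulus_dvd_modulus h)

instance (q : ℕ) : NeZero (modulus q) := ⟨(modulus_pos q).ne'⟩

lemma resetTime_strictMono : StrictMono resetTime :=
  strictMono_nat_of_lt_succ fun k => by
    rw [resetTime_succ]
    exact Nat.lt_add_of_pos_right (modulus_pos k)

lemma resetTime_growth {p q : ℕ} (h : p < q) : 9 * resetTime p + 16 * q ≤ resetTime q := by
  obtain ⟨r, rfl⟩ := Nat.exists_eq_add_of_lt h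
  have hmono : resetTime p ≤ resetTime (p + r) := resetTime_strictMono.monotone (by omega)
  have := resetTime_le_modulus (p + r)
  rw [resetTime_succ]
  omega

lemma natCast_resetTime_of_le {q k : ℕ} (h : q ≤ k) :
    (resetTime k : ZMod (modulus q)) = resetTime q := by
  induction k, h using Nat.le_induction with
  | base => rfl
  | succ k hk ih =>
    rw [resetTime_succ, Nat.cast_add, ih,
      (ZMod.natCast_eq_zero_iff _ _).2 (modulus_dvd_modulus hk), add_zero]

lemma exists_le_natCast_resetTime_eq (q k : ℕ) :
    ∃ i ≤ q, (resetTime k : ZMod (modulus q)) = resetTime i := by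
  rcases le_total k q with h | h
  · exact ⟨k, h, rfl⟩
  · exact ⟨q, le_rfl, natCast_resetTime_of_le h⟩

/-- The time elapsed since the last `resetTime`. -/
noncomputable abbrev age : ℕ → ℕ := elapsed (Set.range resetTime)

lemma exists_resetTime_add_age_eq (n : ℕ) : ∃ k, resetTime k + age n = n := by
  obtain ⟨-, ⟨k, rfl⟩, hk⟩ := exists_mem_add_elapsed_eq (S := Set.range resetTime) ⟨0, rfl⟩ n
  exact ⟨k, hk⟩

end ResetTimes

section ReturnSets

/-- The integers that returns of levels `p < q` have to avoid, because modulo `modulus q` they are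
within `2 * q` of some `resetTime k` or `-resetTime k`. Only integers of size at least
`modulus q / 2` can cause a conflict at level `q`; the smaller ones are exempted so that
`forbidden q` is sparse from the start. -/
def forbidden (q : ℕ) : Set ℕ :=
  {m | modulus q ≤ 2 * m ∧ ∃ (k : ℕ) (e : ℤ), |e| ≤ 2 * q ∧
    ((m : ZMod (modulus q)) = resetTime k + e ∨ (m : ZMod (modulus q)) = -resetTime k + e)}

/-- The times at which the orbit of the very frequently hypercyclic vector is to approximate the
target of level `p`. -/
def returnSet (p : ℕ) : Set ℕ :=
  {m | 0 < m ∧ modulus p ∣ m ∧ ∀ q, p < q → m ∉ forbidden q}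

lemma modulus_le_two_mul_of_dvd {p m n k d t : ℕ} (hm : modulus p ∣ m) (hnm : n < m) (ht : t ≤ p)
    (hd : d < 2 * p) (h : n + resetTime k + d = m + t) : modulus p ≤ 2 * n := by
  have hsize := resetTime_le_modulus p
  obtain ⟨i, hip, hpos, hi⟩ : ∃ i ≤ p, t < n + resetTime i + d ∧
      (resetTime k : ZMod (modulus p)) = resetTime i := by
    rcases le_total k p with hkp | hkp
    · exact ⟨k, hkp, by omega, rfl⟩
    · have := resetTime_growth (p := 0) (q := p) (by omega)
      exact ⟨p, le_rfl, by omega, natCast_resetTime_of_le hkp⟩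
  have hmono : resetTime i ≤ resetTime p := resetTime_strictMono.monotone hip
  by_contra! hlt
  refine intCast_ne_zero_of_pos_of_lt (N := modulus p) (z := n + resetTime i + d - t)
    (by omega) (by omega) ?_
  have hcast := congrArg (Nat.cast : ℕ → ZMod (modulus p)) h
  push_cast [(ZMod.natCast_eq_zero_iff _ _).2 hm] at hcast ⊢
  linear_combination hcast - hi

lemma le_age_of_dvd {p c t : ℕ} (hc0 : 0 < c) (hc : modulus p ∣ c) (ht : t ≤ p) :
    2 * p ≤ age (c + t) := by
  obtain ⟨k, hk⟩ := exists_resetTime_add_age_eq (c + t)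
  by_contra! hlt
  have := modulus_le_two_mul_of_dvd (n := 0) hc hc0 ht hlt (by rwa [zero_add])
  have := modulus_pos p
  omega

lemma le_age_sub_of_dvd_right {q m n t : ℕ} (hm : m ∉ forbidden q) (hn0 : 0 < n)
    (hn : modulus q ∣ n) (hnm : n < m) (ht : t ≤ q) : 2 * q ≤ age (m - n + t) := by
  obtain ⟨k, hk⟩ := exists_resetTime_add_age_eq (m - n + t)
  by_contra! hlt
  have hle := Nat.le_of_dvd hn0 hn
  refine hm ⟨by omega, k, age (m - n + t) - t, abs_le.2 ⟨by omega, by omega⟩, Or.inl ?_⟩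
  have hcast := congrArg (Nat.cast : ℕ → ZMod (modulus q)) hk
  push_cast [Nat.cast_sub hnm.le, (ZMod.natCast_eq_zero_iff _ _).2 hn] at hcast ⊢
  linear_combination -hcast

lemma le_age_sub_of_dvd_left {p m n t : ℕ} (hn : n ∉ forbidden p) (hm : modulus p ∣ m)
    (hnm : n < m) (ht : t ≤ p) : 2 * p ≤ age (m - n + t) := by
  obtain ⟨k, hk⟩ := exists_resetTime_add_age_eq (m - n + t)
  by_contra! hlt
  refine hn ⟨modulus_le_two_mul_of_dvd (k := k) hm hnm ht hlt (by omega), k,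
    t - age (m - n + t), abs_le.2 ⟨by omega, by omega⟩, Or.inr ?_⟩
  have hcast := congrArg (Nat.cast : ℕ → ZMod (modulus p)) hk
  push_cast [Nat.cast_sub hnm.le, (ZMod.natCast_eq_zero_iff _ _).2 hm] at hcast ⊢
  linear_combination hcast

lemma le_age_sub {p q m n t : ℕ} (hm : m ∈ returnSet p) (hn : n ∈ returnSet q) (hnm : n < m)
    (ht : t ≤ p) : 2 * max p q ≤ age (m - n + t) := by
  rcases lt_trichotomy p q with hpq | rfl | hpq
  · rw [max_eq_right hpq.le]
    exact le_age_sub_of_dvd_right (hm.2.2 q hpq) hn.1 hn.2.1 hnm (ht.trans hpq.le)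
  · rw [max_self]
    exact le_age_of_dvd (Nat.sub_pos_of_lt hnm) (Nat.dvd_sub hm.2.1 hn.2.1) ht
  · rw [max_eq_left hpq.le]
    exact le_age_sub_of_dvd_left (hn.2.2 p hpq) hm.2.1 hnm ht

lemma le_age_add {p m t K : ℕ} (hm : m ∈ returnSet p) (ht : t ≤ p)
    (hK : resetTime (K + 1) ≤ m + t) : 2 * max p K ≤ age (m + t) := by
  rcases le_or_gt K p with hKp | hKp
  · rw [max_eq_left hKp]
    exact le_age_of_dvd hm.1 hm.2.1 ht
  rw [max_eq_right hKp.le]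
  by_contra! hlt
  obtain ⟨k, hk⟩ := exists_resetTime_add_age_eq (m + t)
  have hlast : resetTime (K + 1) + age (m + t) ≤ m + t := add_elapsed_le_of_mem ⟨K + 1, rfl⟩ hK
  have hKk : K + 1 ≤ k := resetTime_strictMono.le_iff_le.1 (by omega)
  obtain ⟨r, rfl⟩ := Nat.exists_eq_add_of_le' (show 1 ≤ k by omega)
  have hsize := resetTime_le_modulus r
  have hsucc := resetTime_succ r
  refine hm.2.2 r (by omega) ⟨by omega, r + 1, age (m + t) - t,
    abs_le.2 ⟨by omega, by omega⟩, Or.inl ?_⟩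
  have hcast := congrArg (Nat.cast : ℕ → ZMod (modulus r)) hk
  push_cast at hcast ⊢
  linear_combination -hcast

lemma mem_forbidden_of_dvd {q m : ℕ} (hm0 : 0 < m) (hm : modulus q ∣ m) : m ∈ forbidden q :=
  ⟨by have := Nat.le_of_dvd hm0 hm; omega, 0, 0, by simp,
    Or.inl (by simp [resetTime, (ZMod.natCast_eq_zero_iff _ _).2 hm])⟩

lemma eq_of_mem_returnSet {p q m : ℕ} (hp : m ∈ returnSet p) (hq : m ∈ returnSet q) : p = q := by
  rcases lt_trichotomy p q with hpq | rfl | hpq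
  · exact absurd (mem_forbidden_of_dvd hq.1 hq.2.1) (hp.2.2 q hpq)
  · rfl
  · exact absurd (mem_forbidden_of_dvd hp.1 hp.2.1) (hq.2.2 p hpq)

lemma isSeparatedFamily_returnSet : IsSeparatedFamily (fun n => 2 ^ age n) returnSet where
  index_eq := eq_of_mem_returnSet
  gap {p q m n} hm hn hnm := by
    have hle : 2 * max p q ≤ m - n := (le_age_sub hm hn hnm p.zero_le).trans (elapsed_le _ _)
    omega
  weight_sub hm hn hnm ht := by
    rw [show (4 : ℝ) = 2 ^ 2 by norm_num, ← pow_mul]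
    exact pow_le_pow_right₀ one_le_two (le_age_sub hm hn hnm ht)
  weight_add K := by
    filter_upwards [eventually_ge_atTop (resetTime (K + 1))] with _ hK p m t hm ht rfl
    rw [show (4 : ℝ) = 2 ^ 2 by norm_num, ← pow_mul]
    exact pow_le_pow_right₀ one_le_two (le_age_add hm ht hK)

lemma notMem_forbidden {p q Q l : ℕ} (hpq : p < q) (hqQ : q ≤ Q) :
    l * modulus Q + 2 * (resetTime Q - resetTime p) ∉ forbidden q := by
  -- Modulo `modulus q` the number is `2 * (resetTime q - resetTime p)`; since `resetTime q` far
  -- exceeds `resetTime p`, this is further out than any `resetTime i` with `i ≤ q`.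
  rintro ⟨-, k, e, he, hmod⟩
  have hpQ : resetTime p ≤ resetTime Q := resetTime_strictMono.monotone (hpq.le.trans hqQ)
  obtain ⟨i, hiq, hi⟩ := exists_le_natCast_resetTime_eq q k
  have hmono : resetTime i ≤ resetTime q := resetTime_strictMono.monotone hiq
  have hgrowth := resetTime_growth hpq
  have hsize := resetTime_le_modulus q
  rw [abs_le] at he
  push_cast [Nat.cast_sub hpQ, natCast_resetTime_of_le hqQ, hi,
    (ZMod.natCast_eq_zero_iff _ _).2 (modulus_dvd_modulus hqQ)] at hmod
  rcases hmod with hmod | hmod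
  · refine intCast_ne_zero_of_pos_of_lt (N := modulus q)
      (z := 2 * (resetTime q - resetTime p) - resetTime i - e) (by omega) (by omega) ?_
    push_cast
    linear_combination hmod
  · refine intCast_ne_zero_of_pos_of_lt (N := modulus q)
      (z := 2 * (resetTime q - resetTime p) + resetTime i - e) (by omega) (by omega) ?_
    push_cast
    linear_combination hmod

lemma exists_add_mem_returnSet_or_mem_forbidden {p Q : ℕ} (hpQ : p ≤ Q) (k : ℕ) :
    ∃ n ≤ 2 * modulus Q, k + n ∈ returnSet p ∨ ∃ q > Q, k + n ∈ forbidden q := by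
  set u := (k / modulus Q + 1) * modulus Q + 2 * (resetTime Q - resetTime p) with hu
  have hdiv : modulus Q * (k / modulus Q) + k % modulus Q = k := Nat.div_add_mod k _
  have hmod : k % modulus Q < modulus Q := Nat.mod_lt _ (modulus_pos Q)
  have hsize := resetTime_le_modulus Q
  have hu' : u = modulus Q * (k / modulus Q) + modulus Q + 2 * (resetTime Q - resetTime p) := by
    rw [hu]
    ring
  refine ⟨u - k, by omega, ?_⟩
  rw [Nat.add_sub_cancel' (by omega), or_iff_not_imp_right]
  intro hnot
  push Not at hnot
  have hdvd : modulus p ∣ resetTime Q - resetTime p :=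
    (Nat.modEq_iff_dvd' (resetTime_strictMono.monotone hpQ)).1
      ((ZMod.natCast_eq_natCast_iff _ _ _).1 (natCast_resetTime_of_le hpQ).symm)
  refine ⟨by omega, ?_, fun q hpq => ?_⟩
  · exact dvd_add (dvd_mul_of_dvd_right (modulus_dvd_modulus hpQ) _) (dvd_mul_of_dvd_right hdvd _)
  · exact (le_or_gt q Q).elim (notMem_forbidden hpq) (hnot q)

lemma exists_forbidden_subset_setOf_natCast_mem (q : ℕ) :
    ∃ R : Finset (ZMod (modulus q)), R.card ≤ 8 * (q + 1) ^ 2 ∧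
      forbidden q ⊆ {m | modulus q ≤ 2 * m ∧ (m : ZMod (modulus q)) ∈ R} := by
  classical
  let I := Finset.range (q + 1) ×ˢ Finset.Icc (-(2 * q) : ℤ) (2 * q)
  refine ⟨I.image (fun x => (resetTime x.1 + x.2 : ZMod (modulus q))) ∪
    I.image (fun x => (-resetTime x.1 + x.2 : ZMod (modulus q))), ?_, ?_⟩
  · have hI : I.card = (q + 1) * (4 * q + 1) := by
      rw [Finset.card_product, Finset.card_range, Int.card_Icc]
      congr 1
      omega
    calc _ ≤ I.card + I.card :=
          (Finset.card_union_le _ _).trans (add_le_add Finset.card_image_le Finset.card_image_le)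
      _ ≤ 8 * (q + 1) ^ 2 := by rw [hI]; nlinarith
  · rintro m ⟨hm, k, e, he, hmod⟩
    obtain ⟨i, hiq, hi⟩ := exists_le_natCast_resetTime_eq q k
    have hmem : (i, e) ∈ I :=
      Finset.mem_product.2 ⟨Finset.mem_range_succ_iff.2 hiq, Finset.mem_Icc.2 (abs_le.1 he)⟩
    rw [hi] at hmod
    exact ⟨hm, Finset.mem_union.2 (hmod.imp
      (fun h => Finset.mem_image.2 ⟨_, hmem, h.symm⟩)
      fun h => Finset.mem_image.2 ⟨_, hmem, h.symm⟩)⟩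

lemma ncard_forbidden_succ_le (q M : ℕ) :
    ((forbidden (q + 1) ∩ Set.Icc 0 M).ncard : ℝ) ≤ M / modulus q ^ 2 * (1 / 2) ^ (q + 1) := by
  obtain ⟨R, hR, hsub⟩ := exists_forbidden_subset_setOf_natCast_mem (q + 1)
  have hcount : (forbidden (q + 1) ∩ Set.Icc 0 M).ncard * modulus (q + 1) ≤
      24 * (q + 2) ^ 2 * M :=
    calc _ ≤ _ * modulus (q + 1) := Nat.mul_le_mul_right _ <| Set.ncard_le_ncard
          (Set.inter_subset_inter_left _ hsub) ((Set.finite_Icc 0 M).subset Set.inter_subset_right)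
      _ ≤ 3 * R.card * M := ncard_setOf_natCast_mem_mul_le R M
      _ ≤ 3 * (8 * (q + 1 + 1) ^ 2) * M := by gcongr
      _ = 24 * (q + 2) ^ 2 * M := by ring
  have hcount' : ((forbidden (q + 1) ∩ Set.Icc 0 M).ncard : ℝ) *
      (modulus q ^ 2 * (24 * (q + 2) ^ 2 * 2 ^ (q + 1))) ≤ 24 * (q + 2) ^ 2 * M := by
    exact_mod_cast hcount
  have hN : (0 : ℝ) < modulus q := mod_cast modulus_pos q
  rw [one_div_pow, ← div_eq_mul_one_div, div_div, le_div_iff₀ (by positivity)]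
  refine le_of_mul_le_mul_left ?_ (show (0 : ℝ) < 24 * (q + 2) ^ 2 by positivity)
  linarith

lemma le_of_mem_forbidden {q m : ℕ} (hm : m ∈ forbidden q) : q ≤ m := by
  have := hm.1
  have := resetTime_le_modulus q
  omega

lemma ncard_iUnion_forbidden_le (Q M : ℕ) :
    (({m | ∃ q > Q, m ∈ forbidden q} ∩ Set.Icc 0 M).ncard : ℝ) ≤
      M / modulus Q ^ 2 * (1 / 2) ^ Q := by
  have hsub : {m | ∃ q > Q, m ∈ forbidden q} ∩ Set.Icc 0 M ⊆
      ⋃ j ∈ Finset.range M, forbidden (Q + j + 1) ∩ Set.Icc 0 M := by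
    rintro m ⟨⟨q, hq, hm⟩, hmM⟩
    have := le_of_mem_forbidden hm
    have := hmM.2
    refine Set.mem_biUnion (x := q - Q - 1) (Finset.mem_coe.2 (Finset.mem_range.2 (by omega))) ?_
    rw [show Q + (q - Q - 1) + 1 = q by omega]
    exact ⟨hm, hmM⟩
  have hterm (j : ℕ) : ((forbidden (Q + j + 1) ∩ Set.Icc 0 M).ncard : ℝ) ≤
      M / modulus Q ^ 2 * (1 / 2) ^ (Q + 1) * (1 / 2) ^ j := by
    have hN : (0 : ℝ) < modulus Q := mod_cast modulus_pos Q
    calc _ ≤ M / (modulus (Q + j) : ℝ) ^ 2 * (1 / 2) ^ (Q + j + 1) := ncard_forbidden_succ_le _ _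
      _ ≤ M / (modulus Q : ℝ) ^ 2 * (1 / 2) ^ (Q + j + 1) := by
        gcongr
        exact modulus_mono (Nat.le_add_right _ _)
      _ = _ := by ring
  have hfin : (⋃ j ∈ Finset.range M, forbidden (Q + j + 1) ∩ Set.Icc 0 M).Finite :=
    (Finset.finite_toSet _).biUnion fun j _ => (Set.finite_Icc 0 M).subset Set.inter_subset_right
  calc _ ≤ ∑ j ∈ Finset.range M, ((forbidden (Q + j + 1) ∩ Set.Icc 0 M).ncard : ℝ) :=
        mod_cast (Set.ncard_le_ncard hsub hfin).trans (Finset.set_ncard_biUnion_le _ _)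
    _ ≤ ∑ j ∈ Finset.range M, M / (modulus Q : ℝ) ^ 2 * (1 / 2) ^ (Q + 1) * (1 / 2) ^ j :=
        Finset.sum_le_sum fun j _ => hterm j
    _ = M / (modulus Q : ℝ) ^ 2 * (1 / 2) ^ (Q + 1) * ∑ j ∈ Finset.range M, (1 / 2 : ℝ) ^ j := by
        rw [Finset.mul_sum]
    _ ≤ M / (modulus Q : ℝ) ^ 2 * (1 / 2) ^ (Q + 1) * 2 := by
        gcongr
        exact sum_geometric_two_le M
    _ = _ := by ring

lemma ncard_gaps_returnSet_le {p Q : ℕ} (hpQ : p ≤ Q) (M : ℕ) :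
    (({k | ∀ n ≤ 2 * modulus Q, k + n ∉ returnSet p} ∩ Set.Icc 0 M).ncard : ℝ) ≤
      (M + 2 * modulus Q) * (1 / 2) ^ Q := by
  have hsub : {k | ∀ n ≤ 2 * modulus Q, k + n ∉ returnSet p} ⊆
      {k | ∃ n ≤ 2 * modulus Q, k + n ∈ {m | ∃ q > Q, m ∈ forbidden q}} := fun k hk => by
    obtain ⟨n, hn, hkn⟩ := exists_add_mem_returnSet_or_mem_forbidden hpQ k
    exact ⟨n, hn, hkn.resolve_left (hk n hn)⟩
  have hN : (3 : ℝ) ≤ modulus Q := by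
    have := resetTime_le_modulus Q
    exact_mod_cast (show 3 ≤ modulus Q by omega)
  have hcount := (Set.ncard_le_ncard (Set.inter_subset_inter_left (Set.Icc 0 M) hsub)
    ((Set.finite_Icc 0 M).subset Set.inter_subset_right)).trans
      (ncard_setOf_exists_add_mem_le _ _ M)
  calc _ ≤ (2 * modulus Q + 1 : ℝ) *
        ({m | ∃ q > Q, m ∈ forbidden q} ∩ Set.Icc 0 (M + 2 * modulus Q)).ncard := mod_cast hcount
    _ ≤ modulus Q ^ 2 *
        (((M + 2 * modulus Q : ℕ) : ℝ) / modulus Q ^ 2 * (1 / 2) ^ Q) := by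
        gcongr
        · nlinarith
        · exact ncard_iUnion_forbidden_le Q _
    _ = _ := by
        push_cast
        field_simp

lemma returnSet_mem_hindmanFamily (p : ℕ) : returnSet p ∈ hindmanFamily := by
  refine mem_hindmanFamily_of_sparse_gaps fun δ hδ => ?_
  have hsmall : ∀ᶠ Q : ℕ in atTop, (1 / 2 : ℝ) ^ Q < δ / 2 :=
    (tendsto_pow_atTop_nhds_zero_of_lt_one (by norm_num) one_half_lt_one).eventually_lt_const
      (half_pos hδ)
  obtain ⟨Q, hQ, hpQ⟩ := (hsmall.and (eventually_ge_atTop p)).exists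
  refine ⟨2 * modulus Q, ?_⟩
  filter_upwards [eventually_ge_atTop (2 * modulus Q)] with M hM
  have hM' : (2 * modulus Q : ℝ) ≤ M := mod_cast hM
  calc _ ≤ (M + 2 * modulus Q) * (1 / 2 : ℝ) ^ Q := ncard_gaps_returnSet_le hpQ M
    _ ≤ (M + M) * (δ / 2) := by gcongr
    _ ≤ δ * (M + 1) := by linarith

end ReturnSets

section Weights

variable (𝕜 : Type*) [RCLike 𝕜]

lemma exists_isWeightedBackwardShift_norm_weightProduct_eq (S : Set ℕ) :
    ∃ (w : ℕ → 𝕜) (T : C₀(ℕ, 𝕜) →L[𝕜] C₀(ℕ, 𝕜)), IsWeightedBackwardShift w T ∧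
      ∀ n, ‖weightProduct w n‖ = 2 ^ elapsed S n := by
  let W (n : ℕ) : 𝕜 := 2 ^ elapsed S n
  have hW (n : ℕ) : W n ≠ 0 := pow_ne_zero _ two_ne_zero
  have hnorm (n : ℕ) : ‖W n‖ = 2 ^ elapsed S n := by simp [W]
  have hbound (n : ℕ) : ‖W n / W (n - 1)‖ ≤ 2 := by
    rw [norm_div, hnorm, hnorm, div_le_iff₀ (by positivity), ← pow_succ']
    refine pow_le_pow_right₀ one_le_two ?_
    cases n with
    | zero => exact Nat.le_succ _
    | succ n => exact elapsed_succ_le S n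
  obtain ⟨T, hT⟩ := exists_isWeightedBackwardShift (fun n => div_ne_zero (hW n) (hW _)) hbound
  exact ⟨_, T, hT, fun n => by rw [weightProduct_div_pred hW (by simp [W, elapsed]), hnorm]⟩

lemma exists_isVeryFrequentlyHypercyclic_not_tendsto_norm_weightProduct :
    ∃ (w : ℕ → 𝕜) (T : C₀(ℕ, 𝕜) →L[𝕜] C₀(ℕ, 𝕜)), IsWeightedBackwardShift w T ∧
      IsVeryFrequentlyHypercyclic T ∧ ¬ Tendsto (fun n => ‖weightProduct w n‖) atTop atTop := by
  obtain ⟨w, T, hT, hnorm⟩ :=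
    exists_isWeightedBackwardShift_norm_weightProduct_eq 𝕜 (Set.range resetTime)
  have hsep : IsSeparatedFamily (fun n => ‖weightProduct w n‖) returnSet := by
    simpa only [hnorm] using isSeparatedFamily_returnSet
  have hinf : (Set.range resetTime).Infinite :=
    Set.infinite_range_of_injective resetTime_strictMono.injective
  refine ⟨w, T, hT,
    hT.isFamilyHypercyclic hsep isUpperSet_hindmanFamily returnSet_mem_hindmanFamily, ?_⟩
  simpa only [hnorm] using not_tendsto_two_pow_elapsed hinf

end Weights

end LinearDynamics

theorem theorem7p4 (𝕜 : Type*) [RCLike 𝕜] [MeasurableSpace C₀(ℕ, 𝕜)] [BorelSpace C₀(ℕ, 𝕜)] :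
    ∃ (w : ℕ → 𝕜) (T : C₀(ℕ, 𝕜) →L[𝕜] C₀(ℕ, 𝕜)),
      LinearDynamics.IsWeightedBackwardShift w T ∧
      LinearDynamics.IsVeryFrequentlyHypercyclic T ∧
      ¬ LinearDynamics.IsChaotic T ∧
      (∀ c : 𝕜, ‖c‖ = 1 → ¬ Module.End.HasEigenvalue (T : C₀(ℕ, 𝕜) →ₗ[𝕜] C₀(ℕ, 𝕜)) c) ∧
      ¬ LinearDynamics.IsTopologicallyMixing T ∧
      (∀ μ : Measure C₀(ℕ, 𝕜), IsGaussian μ → MeasurePreserving T μ μ →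
        μ = Measure.dirac 0) := by
  obtain ⟨w, T, hT, hvfhc, hw⟩ :=
    LinearDynamics.exists_isVeryFrequentlyHypercyclic_not_tendsto_norm_weightProduct 𝕜
  exact ⟨w, T, hT, hvfhc,
    fun hchaotic => hT.not_dense_periodicPts hw hchaotic.2,
    fun c hc => hT.not_hasEigenvalue hw hc.ge,
    hT.not_isTopologicallyMixing hw,
    fun μ _ hμ => hT.eq_dirac_zero_of_measurePreserving hw hμ⟩
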